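/- Let $d\ge 2$. A domain is a nonempty connected open set $\Omega\subsetneq\mathbb{R}^d$, and $\rho(x):=d(x,\partial\Omega)$. For $R>0$ let $\delta_\Omega(R)$ be the infimum of all $\delta\in[0,1]$ such that for every $p\in\partial\Omega$ and every connected component $C$ of $\Omega\cap B(p,R)$ there is a unit vector $e\in\mathbb{R}^d$ with $(x-p)\cdot e<\delta R$ for all $x\in C$. For $\delta\in[0,1]$ and $0<R_{0,\delta}\le R_{\infty,\delta}<\infty$, the domain $\Omega$ satisfies $\langle\mathrm{TER}\rangle_\delta$ (the totally $\delta$-exterior Reifenberg condition) with constants $R_{0,\delta},R_{\infty,\delta}$ if $\delta_\Omega(R)\le\delta$ for every $R>0$ with $R\le R_{0,\delta}$ or $R\ge R_{\infty,\delta}$. For $0<\nu_1\le\nu_2$ let $\mathrm{M}(\nu_1,\nu_2)$ be the set of real symmetric $d\times d$ matrices $(\alpha^{ij})$ with $\nu_1|\xi|^2\le\sum_{i,j=1}^d\alpha^{ij}\xi_i\xi_j\le\nu_2|\xi|^2$ for all $\xi\in\mathbb{R}^d$. **Theorem.** For any $\nu\in(0,1]$ and $\epsilon\in(0,1)$ there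 exists $\delta_1>0$, depending only on $d,\epsilon,\nu$, such that the following holds. If a domain $\Omega$ satisfies $\langle\mathrm{TER}\rangle_\delta$ with constants $R_{0,\delta},R_{\infty,\delta}$ for some $\delta\in[0,1]$ with $\delta\le\delta_1$, then there exists a measurable, locally integrable function $\phi:\Omega\to\mathbb{R}$ such that: 1. for every $(\alpha^{ij})\in\mathrm{M}(\nu^2,1)$, $\sum_{i,j=1}^d\alpha^{ij}D_{ij}\phi\le 0$ on $\Omega$ in the sense of distributions, i.e. $\int_\Omega\phi\sum_{i,j=1}^d\alpha^{ij}D_{ij}\zeta\,dx\le 0$ for every nonnegative $\zeta\in C_c^\infty(\Omega)$; 2. there is a constant $N>0$, depending only on $d,\nu,\epsilon$ and $R_{0,\delta}/R_{\infty,\delta}$, such that $$N^{-1}\rho(x)^{1-\epsilon}\le\phi(x)\le N\rho(x)^{1-\epsilon}\qquad\text{for all }x\in\Omega .$$ -/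

import Mathlib

open scoped ContDiff

namespace ExteriorReifenberg

/-- `exteriorPairs Ω` is the set of all `(δ, R) ∈ [0,1] × (0,∞)` such that for every boundary point
`p` and every connected component `C` of `Ω ∩ B(p,R)` there is a unit vector `e` with
`C ⊆ {x ∈ B(p,R) : (x - p) · e < δ R}`.  The components of `Ω ∩ B(p,R)` are enumerated by
their points `z`. -/
def exteriorPairs {d : ℕ} (Ω : Set (EuclideanSpace ℝ (Fin d))) : Set (ℝ × ℝ) :=
  {q | q.1 ∈ Set.Icc (0 : ℝ) 1 ∧ 0 < q.2 ∧
    ∀ p ∈ frontier Ω, ∀ z ∈ Ω ∩ Metric.ball p q.2,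
      ∃ e : EuclideanSpace ℝ (Fin d), ‖e‖ = 1 ∧
        connectedComponentIn (Ω ∩ Metric.ball p q.2) z ⊆
          {x | x ∈ Metric.ball p q.2 ∧ inner ℝ (x - p) e < q.1 * q.2}}

/-- `δ_Ω(R)`: the infimum of all `δ` such that `(δ, R) ∈ exteriorPairs Ω`.  For `d ≥ 1` and
`R > 0` the value `δ = 1` is always admissible, so this is a genuine infimum in `[0,1]`. -/
noncomputable def exteriorFlatness {d : ℕ} (Ω : Set (EuclideanSpace ℝ (Fin d))) (R : ℝ) : ℝ :=
  sInf {δ : ℝ | (δ, R) ∈ exteriorPairs Ω}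

/-- `Ω` satisfies the totally `δ`-exterior Reifenberg condition with the constants
`0 < R₀ ≤ R∞ < ∞`. -/
structure IsTotallyExterior {d : ℕ} (Ω : Set (EuclideanSpace ℝ (Fin d))) (δ R₀ Rinf : ℝ) :
    Prop where
  delta_mem : δ ∈ Set.Icc (0 : ℝ) 1
  pos : 0 < R₀
  le : R₀ ≤ Rinf
  flat : ∀ R : ℝ, 0 < R → (R ≤ R₀ ∨ Rinf ≤ R) → exteriorFlatness Ω R ≤ δ

/-- `M(ν₁, ν₂)`: the real symmetric `d × d` matrices `α` with
`ν₁ |ξ|² ≤ ∑ α^{ij} ξ_i ξ_j ≤ ν₂ |ξ|²` for all `ξ ∈ ℝ^d`. -/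
def ellipticMatrices (d : ℕ) (ν₁ ν₂ : ℝ) : Set (Matrix (Fin d) (Fin d) ℝ) :=
  {α | α.IsSymm ∧ ∀ ξ : EuclideanSpace ℝ (Fin d),
    ν₁ * ‖ξ‖ ^ 2 ≤ ∑ i, ∑ j, α i j * ξ i * ξ j ∧
      ∑ i, ∑ j, α i j * ξ i * ξ j ≤ ν₂ * ‖ξ‖ ^ 2}

/-- The partial derivative `D_i f`. -/
noncomputable def partialD {d : ℕ} (i : Fin d) (f : EuclideanSpace ℝ (Fin d) → ℝ)
    (x : EuclideanSpace ℝ (Fin d)) : ℝ :=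
  fderiv ℝ f x (EuclideanSpace.single i 1)

/-- `∑ α^{ij} D_{ij} φ ≤ 0` on `Ω` in the sense of distributions: `φ` is locally integrable on
`Ω`, and `∫_Ω φ ∑ α^{ij} D_{ij} ζ ≤ 0` for all nonnegative `ζ ∈ C_c^∞(Ω)`. -/
def DistribSuper {d : ℕ} (Ω : Set (EuclideanSpace ℝ (Fin d)))
    (α : Matrix (Fin d) (Fin d) ℝ) (φ : EuclideanSpace ℝ (Fin d) → ℝ) : Prop :=
  MeasureTheory.LocallyIntegrableOn φ Ω MeasureTheory.volume ∧
    ∀ ζ : EuclideanSpace ℝ (Fin d) → ℝ, ContDiff ℝ ∞ ζ → HasCompactSupport ζ →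
      tsupport ζ ⊆ Ω → (∀ x, 0 ≤ ζ x) →
        ∫ x in Ω, φ x * ∑ i, ∑ j, α i j * partialD j (partialD i ζ) x ≤ 0

end ExteriorReifenberg

/-!
The function `φ` is an explicit lower envelope of quadratic polynomials.

Fix `K = d / ν ^ 2`. In a ball `B(p, R)` about a boundary point, let a component of `Ω ∩ B(p, R)`
lie in the half-space `⟪y - p, e⟫ < 2 δ₁ R`.  With `s = 3 δ₁ - ⟪y, e⟫`, the polynomial
`‖y‖ ^ 2 + K s (5 - s)` is bounded below by `‖y‖ ^ 2 + K δ₁` and above by a multiple of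
`δ₁ + ‖y‖` on the rescaled component, and `K` is so large that it is a supersolution for every
matrix in `M(ν ^ 2, 1)`.  The barrier of scale `R` is this polynomial at `(x - p) / R`, times a
weight comparable to `R ^ (1 - ε)`; `φ x` is the infimum of all barriers available at `x`
(`barrierInf`).  The two bounds on `φ` follow from those on the polynomial, since all scales `R`
available at `x` exceed `ρ(x)` and one of them is comparable to `ρ(x)`.

The infimum is over a family that depends on `x`, so the supersolution property needs that barriers
are irrelevant near the boundary of their balls.  For `‖x - p‖ ≥ R / 2` the barrier of scale `R` is
at least a quarter of its weight, whereas the one of scale `M R` about the same `p` is at most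
`(M R) ^ (1 - ε) * (1 + 20 K) / M`, which is no larger if `M ^ ε = 4 (1 + 20 K)` and `δ₁ = 1 / M`
(`IsAdmissible.exists_barrier_le`).  Hence `φ x` may be computed with barriers such that
`R ≥ 2 ‖x - p‖ ≥ 2 ρ(x)`; these dominate `φ` on all of `B(x, ρ(x))`, as that ball lies in the
component of `x`.  Scales between `R₀` and `R∞` are not used at all: the weights of the scales below
`R₀` carry a factor depending on `R₀ / R∞` that lets the comparison jump over the gap
(`exists_larger_scale`).

Writing `α = ∑ b_k b_kᵀ`, it follows that
`∑ (φ(x + h b_k) + φ(x - h b_k) - 2 φ(x)) ≤ 0` holds exactly for all small `h`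
(`sum_secondDifference_barrierInf_nonpos`).  Moving the differences onto the test function and
letting `h → 0` gives the distributional inequality (`distribSuper_of_secondDifference_nonpos`).
-/

/-! ### Second differences and distributional supersolutions -/

namespace ExteriorReifenberg

open Metric Set MeasureTheory

/-- The second difference quotients of a test function converge uniformly to its second
derivative. -/
theorem abs_secondDifference_sub_le {E : Type*} [NormedAddCommGroup E] [NormedSpace ℝ E]
    {ζ : E → ℝ} (hζ : ContDiff ℝ ∞ ζ) (hc : HasCompactSupport ζ) (v : E) {η : ℝ} (hη : 0 < η) :
    ∃ h₀ : ℝ, 0 < h₀ ∧ ∀ h : ℝ, 0 < h → h < h₀ → ∀ x : E,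
      |ζ (x + h • v) + ζ (x - h • v) - 2 * ζ x
        - h ^ 2 * fderiv ℝ (fun y => fderiv ℝ ζ y v) x v| ≤ η * h ^ 2 := by
  set g : E → ℝ := fun y => fderiv ℝ ζ y v with hg
  have hgs : ContDiff ℝ ∞ g := (hζ.fderiv_right (m := ∞) (by simp)).clm_apply contDiff_const
  set q : E → ℝ := fun y => fderiv ℝ g y v with hq
  have hqs : ContDiff ℝ ∞ q := (hgs.fderiv_right (m := ∞) (by simp)).clm_apply contDiff_const
  have hgc : HasCompactSupport g := hc.fderiv_apply ℝ v
  have hqc : HasCompactSupport q := hgc.fderiv_apply ℝ v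
  have hu : UniformContinuous q := hqc.uniformContinuous_of_continuous hqs.continuous
  obtain ⟨r, hr, hqr⟩ := Metric.uniformContinuous_iff.1 hu (η / 2) (by positivity)
  refine ⟨r / (‖v‖ + 1), by positivity, fun h hh hhr x => ?_⟩
  have hline : ∀ s : ℝ, HasDerivAt (fun s : ℝ => x + s • v) v s := fun s => by
    simpa using ((hasDerivAt_id s).smul_const v).const_add x
  have hline' : ∀ s : ℝ, HasDerivAt (fun s : ℝ => x - s • v) (-v) s := fun s => by
    simpa using ((hasDerivAt_id s).smul_const v).const_sub x
  have hgd : ∀ y, HasFDerivAt g (fderiv ℝ g y) y := fun y =>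
    (hgs.differentiable (by simp) y).hasFDerivAt
  have hζd : ∀ y, HasFDerivAt ζ (fderiv ℝ ζ y) y := fun y =>
    (hζ.differentiable (by simp) y).hasFDerivAt
  have hclose : ∀ s ∈ Icc (-h) h, ‖q (x + s • v) - q x‖ ≤ η / 2 := fun s hs => by
    refine (hqr ?_).le
    rw [dist_eq_norm, add_sub_cancel_left, norm_smul]
    have h1 : ‖s‖ ≤ h := abs_le.2 hs
    have h2 : h * (‖v‖ + 1) < r := (lt_div_iff₀ (by positivity)).1 hhr
    nlinarith [norm_nonneg v]
  have hm : ∀ t ∈ Icc (0 : ℝ) h, ‖g (x + t • v) - g (x - t • v) - 2 * t * q x‖ ≤ η * h := by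
    intro t ht
    have hsub : ∀ s ∈ Icc (-h) h,
        HasDerivWithinAt (fun s => g (x + s • v) - s * q x) (q (x + s • v) - q x)
          (Icc (-h) h) s := fun s _ => by
      have h1 := (hgd (x + s • v)).comp_hasDerivAt s (hline s)
      have h2 := h1.fun_sub ((hasDerivAt_id s).mul_const (q x))
      simpa [hq, Function.comp_def] using h2.hasDerivWithinAt
    have := (convex_Icc (-h) h).norm_image_sub_le_of_norm_hasDerivWithin_le hsub hclose
      (x := -t) (y := t) ⟨by linarith [ht.2], by linarith [ht.1]⟩
      ⟨by linarith [ht.1], ht.2⟩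
    have e1 : g (x + t • v) - t * q x - (g (x + (-t) • v) - (-t) * q x)
        = g (x + t • v) - g (x - t • v) - 2 * t * q x := by
      rw [neg_smul, ← sub_eq_add_neg]; ring
    have e2 : ‖t - -t‖ = 2 * t := by
      rw [Real.norm_eq_abs, abs_of_nonneg (by linarith [ht.1])]; ring
    rw [e1, e2] at this
    nlinarith [ht.2]
  have hk : ∀ t ∈ Icc (0 : ℝ) h,
      HasDerivWithinAt (fun t => ζ (x + t • v) + ζ (x - t • v) - 2 * ζ x - t ^ 2 * q x)
        (g (x + t • v) - g (x - t • v) - 2 * t * q x) (Icc (0 : ℝ) h) t := fun t _ => by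
    have h1 := (hζd (x + t • v)).comp_hasDerivAt t (hline t)
    have h2 := (hζd (x - t • v)).comp_hasDerivAt t (hline' t)
    have h3 := (((h1.fun_add h2).sub_const (2 * ζ x)).fun_sub
      (((hasDerivAt_id t).fun_pow 2).mul_const (q x))).hasDerivWithinAt (s := Icc (0 : ℝ) h)
    refine h3.congr_deriv ?_
    simp [hg, sub_eq_add_neg]
  have := (convex_Icc (0 : ℝ) h).norm_image_sub_le_of_norm_hasDerivWithin_le hk hm
    (x := 0) (y := h) ⟨le_rfl, hh.le⟩ ⟨hh.le, le_rfl⟩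
  simp only [zero_smul, add_zero, sub_zero, Real.norm_eq_abs, abs_of_pos hh] at this
  calc _ = |ζ (x + h • v) + ζ (x - h • v) - 2 * ζ x - h ^ 2 * q x
      - (ζ x + ζ x - 2 * ζ x - 0 ^ 2 * q x)| := by congr 1; ring
    _ ≤ η * h * h := this
    _ = η * h ^ 2 := by ring

/-- A matrix with nonnegative lower ellipticity bound is a sum `∑ k, b k (b k)ᵀ`, so that
`∑ α^{ij} D_{ij}` is a sum of pure second derivatives. -/
theorem exists_frame_of_mem_ellipticMatrices {d : ℕ} {ν₁ ν₂ : ℝ} (hν : 0 ≤ ν₁)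
    {α : Matrix (Fin d) (Fin d) ℝ} (hα : α ∈ ellipticMatrices d ν₁ ν₂) :
    ∃ b : Fin d → EuclideanSpace ℝ (Fin d), ∀ i j, α i j = ∑ k, b k i * b k j := by
  have hps : α.PosSemidef := by
    refine Matrix.PosSemidef.of_dotProduct_mulVec_nonneg ?_ fun x => ?_
    · rw [Matrix.IsHermitian, Matrix.conjTranspose_eq_transpose_of_trivial]; exact hα.1
    · have := (hα.2 (WithLp.toLp 2 x)).1
      have h0 : 0 ≤ ν₁ * ‖(WithLp.toLp 2 x : EuclideanSpace ℝ (Fin d))‖ ^ 2 := by positivity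
      refine (h0.trans this).trans_eq ?_
      simp only [dotProduct, Matrix.mulVec, Finset.mul_sum, star_trivial]
      exact Finset.sum_congr rfl fun i _ => Finset.sum_congr rfl fun j _ => by ring
  obtain ⟨B, hB⟩ : ∃ B : Matrix (Fin d) (Fin d) ℝ, α = B.conjTranspose * B := by
    open scoped MatrixOrder in
    exact CStarAlgebra.nonneg_iff_eq_star_mul_self.1 hps.nonneg
  refine ⟨fun k => WithLp.toLp 2 (B k), fun i j => ?_⟩
  rw [hB, Matrix.mul_apply]
  simp

theorem sum_partialD_eq_sum_frame {d : ℕ} {α : Matrix (Fin d) (Fin d) ℝ}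
    {b : Fin d → EuclideanSpace ℝ (Fin d)} (hb : ∀ i j, α i j = ∑ k, b k i * b k j)
    {ζ : EuclideanSpace ℝ (Fin d) → ℝ} (hζ : ContDiff ℝ ∞ ζ) (x : EuclideanSpace ℝ (Fin d)) :
    ∑ i, ∑ j, α i j * partialD j (partialD i ζ) x
      = ∑ k, fderiv ℝ (fun y => fderiv ℝ ζ y (b k)) x (b k) := by
  have hlin : ∀ (l : EuclideanSpace ℝ (Fin d) →L[ℝ] ℝ) (v : EuclideanSpace ℝ (Fin d)),
      l v = ∑ i, v i * l (EuclideanSpace.single i (1 : ℝ)) := fun l v => by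
    have hv : v = ∑ i, v i • EuclideanSpace.single i (1 : ℝ) := by
      ext j
      simp [Finset.sum_apply, Pi.single_apply]
    conv_lhs => rw [hv]
    simp [map_sum]
  have hd : ∀ i, Differentiable ℝ fun y => fderiv ℝ ζ y (EuclideanSpace.single i (1 : ℝ)) :=
    fun i => ((hζ.fderiv_right (m := ∞) (by simp)).clm_apply contDiff_const).differentiable
      (by simp)
  have key : ∀ v : EuclideanSpace ℝ (Fin d),
      fderiv ℝ (fun y => fderiv ℝ ζ y v) x v
        = ∑ i, ∑ j, v i * v j * partialD j (partialD i ζ) x := fun v => by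
    have h1 : (fun y => fderiv ℝ ζ y v)
        = fun y => ∑ i, v i * fderiv ℝ ζ y (EuclideanSpace.single i (1 : ℝ)) :=
      funext fun y => hlin _ v
    rw [h1, fderiv_fun_sum fun i _ => (hd i x).const_mul _, sum_apply]
    refine Finset.sum_congr rfl fun i _ => ?_
    rw [fderiv_const_mul (hd i x), smul_apply, hlin _ v, smul_eq_mul,
      Finset.mul_sum]
    exact Finset.sum_congr rfl fun j _ => (mul_assoc _ _ _).symm
  simp only [key, hb, Finset.sum_mul]
  exact (Finset.sum_congr rfl fun i _ => Finset.sum_comm).trans Finset.sum_comm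

/-- A locally integrable function whose second differences along the frame `b` are nonpositive at
every point, for all steps that stay in `Ω`, is a distributional supersolution. -/
theorem distribSuper_of_secondDifference_nonpos {d : ℕ}
    {Ω : Set (EuclideanSpace ℝ (Fin d))} (hΩ : IsOpen Ω) {α : Matrix (Fin d) (Fin d) ℝ}
    {b : Fin d → EuclideanSpace ℝ (Fin d)} (hb : ∀ i j, α i j = ∑ k, b k i * b k j)
    {φ : EuclideanSpace ℝ (Fin d) → ℝ} (hφ : LocallyIntegrableOn φ Ω volume)
    (hdiff : ∀ (x : EuclideanSpace ℝ (Fin d)) (r h : ℝ), ball x r ⊆ Ω → (∀ k, ‖h • b k‖ < r) →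
      ∑ k, (φ (x + h • b k) + φ (x - h • b k) - 2 * φ x) ≤ 0) :
    DistribSuper Ω α φ := by
  refine ⟨hφ, fun ζ hζ hζc hζΩ hζ0 => ?_⟩
  simp only [sum_partialD_eq_sum_frame hb hζ]
  set T : ℝ → EuclideanSpace ℝ (Fin d) → ℝ := fun h x =>
    ∑ k, (ζ (x + h • b k) + ζ (x - h • b k) - 2 * ζ x) with hT
  set q : EuclideanSpace ℝ (Fin d) → ℝ := fun x =>
    ∑ k, fderiv ℝ (fun y => fderiv ℝ ζ y (b k)) x (b k) with hq
  have hqs : ContDiff ℝ ∞ q := by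
    refine ContDiff.sum fun k _ => ?_
    have h1 : ContDiff ℝ ∞ fun y => fderiv ℝ ζ y (b k) :=
      (hζ.fderiv_right (m := ∞) (by simp)).clm_apply contDiff_const
    exact (h1.fderiv_right (m := ∞) (by simp)).clm_apply contDiff_const
  obtain ⟨r, hr, hrΩ⟩ := IsCompact.exists_cthickening_subset_open hζc hΩ hζΩ
  set K := cthickening r (tsupport ζ) with hK
  have hKc : IsCompact K := hζc.isCompact.cthickening
  have hKm : MeasurableSet K := hKc.isClosed.measurableSet
  have hφK : IntegrableOn φ K volume := hφ.integrableOn_compact_subset hrΩ hKc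
  set ψ : EuclideanSpace ℝ (Fin d) → ℝ := K.indicator φ with hψ
  have hψi : Integrable ψ volume := hφK.integrable_indicator hKm
  have hζK : ∀ x, x ∉ tsupport ζ → ζ x = 0 := fun x hx => image_eq_zero_of_notMem_tsupport hx
  have hqK : ∀ x, x ∉ tsupport ζ → q x = 0 := fun x hx => by
    refine Finset.sum_eq_zero fun k _ => ?_
    have h1 : tsupport (fun y => fderiv ℝ (fun y => fderiv ℝ ζ y (b k)) y (b k)) ⊆ tsupport ζ :=
      (tsupport_fderiv_apply_subset ℝ _).trans (tsupport_fderiv_apply_subset ℝ _)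
    exact image_eq_zero_of_notMem_tsupport
      (f := fun y => fderiv ℝ (fun y => fderiv ℝ ζ y (b k)) y (b k)) fun h => hx (h1 h)
  have hsupK : tsupport ζ ⊆ K := self_subset_cthickening _
  have hint : ∫ x in Ω, φ x * q x = ∫ x, ψ x * q x := by
    rw [← integral_indicator hΩ.measurableSet]
    congr 1
    funext x
    by_cases hx : x ∈ tsupport ζ
    · rw [indicator_of_mem (hζΩ hx), hψ, indicator_of_mem (hsupK hx)]
    · rw [hqK x hx, mul_zero]
      by_cases hx' : x ∈ Ω
      · rw [indicator_of_mem hx', hqK x hx, mul_zero]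
      · rw [indicator_of_notMem hx']
  rw [hint]
  have hi : ∀ f : EuclideanSpace ℝ (Fin d) → ℝ, Continuous f → HasCompactSupport f →
      Integrable (fun x => ψ x * f x) volume := fun f hf hfc => by
    obtain ⟨C, hC⟩ := hfc.exists_bound_of_continuous hf
    exact hψi.mul_bdd hf.aestronglyMeasurable (Filter.Eventually.of_forall hC)
  have hζadd : ∀ v : EuclideanSpace ℝ (Fin d), HasCompactSupport fun x => ζ (x + v) := fun v =>
    hζc.comp_homeomorph (Homeomorph.addRight v)
  have hplus : ∀ v : EuclideanSpace ℝ (Fin d), Integrable (fun x => ψ x * ζ (x + v)) volume :=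
    fun v => hi _ (hζ.continuous.comp (continuous_id.add continuous_const)) (hζadd v)
  have hψζ : ∀ v : EuclideanSpace ℝ (Fin d), Integrable (fun x => ψ (x + v) * ζ x) volume := by
    intro v
    simpa using (hplus (-v)).comp_add_right v
  have hshift : ∀ v : EuclideanSpace ℝ (Fin d),
      ∫ x, ψ x * ζ (x + v) = ∫ x, ψ (x - v) * ζ x := fun v => by
    rw [← integral_add_right_eq_self (fun x => ψ (x - v) * ζ x) v]
    simp
  have hsum3 : ∀ (f g : Fin d → EuclideanSpace ℝ (Fin d) → ℝ) (z : EuclideanSpace ℝ (Fin d) → ℝ),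
      (∀ k, Integrable (f k) volume) → (∀ k, Integrable (g k) volume) → Integrable z volume →
      ∫ x, ∑ k, (f k x + g k x - 2 * z x)
        = ∑ k, ((∫ x, f k x) + (∫ x, g k x) - 2 * ∫ x, z x) := fun f g z hf hg hz => by
    have h1 : ∀ k, Integrable (fun x => f k x + g k x) volume := fun k => (hf k).add (hg k)
    have h2 : ∀ k, Integrable (fun x => f k x + g k x - 2 * z x) volume := fun k =>
      (h1 k).sub (hz.const_mul 2)
    rw [integral_finsetSum _ fun k _ => h2 k]
    refine Finset.sum_congr rfl fun k _ => ?_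
    rw [integral_sub (h1 k) (hz.const_mul 2), integral_add (hf k) (hg k), integral_const_mul]
  -- Discrete integration by parts: translating the integration variable moves the second
  -- differences from the test function to `φ`.
  have hparts : ∀ h : ℝ, ∫ x, ψ x * T h x
      = ∫ x, (∑ k, (ψ (x + h • b k) + ψ (x - h • b k) - 2 * ψ x)) * ζ x := fun h => by
    have hz := hψζ 0
    simp only [add_zero] at hz
    have e1 : ∀ x, ψ x * T h x = ∑ k, (ψ x * ζ (x + h • b k) + ψ x * ζ (x + -(h • b k))
        - 2 * (ψ x * ζ x)) := fun x => by
      rw [hT, Finset.mul_sum]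
      exact Finset.sum_congr rfl fun k _ => by rw [← sub_eq_add_neg]; ring
    have e2 : ∀ x, (∑ k, (ψ (x + h • b k) + ψ (x - h • b k) - 2 * ψ x)) * ζ x
        = ∑ k, (ψ (x + h • b k) * ζ x + ψ (x + -(h • b k)) * ζ x - 2 * (ψ x * ζ x)) :=
      fun x => by
      rw [Finset.sum_mul]
      exact Finset.sum_congr rfl fun k _ => by rw [← sub_eq_add_neg]; ring
    simp only [e1, e2]
    rw [hsum3 _ _ _ (fun k => hplus _) (fun k => hplus _) hz,
      hsum3 _ _ _ (fun k => hψζ _) (fun k => hψζ _) hz]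
    refine Finset.sum_congr rfl fun k _ => ?_
    rw [hshift, hshift]
    simp only [sub_neg_eq_add, ← sub_eq_add_neg]
    ring
  obtain ⟨s, hs, hsb⟩ : ∃ s : ℝ, 0 < s ∧ ∀ h : ℝ, 0 < h → h < s → ∀ k, ‖h • b k‖ < r := by
    refine ⟨r / (∑ k, ‖b k‖ + 1), by positivity, fun h hh hhs k => ?_⟩
    rw [norm_smul, Real.norm_of_nonneg hh.le]
    have h1 : h * (∑ k, ‖b k‖ + 1) < r := (lt_div_iff₀ (by positivity)).1 hhs
    have h2 : ‖b k‖ ≤ ∑ k, ‖b k‖ :=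
      Finset.single_le_sum (f := fun k => ‖b k‖) (fun _ _ => norm_nonneg _) (Finset.mem_univ k)
    nlinarith
  have hTnonpos : ∀ h : ℝ, 0 < h → h < s → ∫ x, ψ x * T h x ≤ 0 := fun h hh hhs => by
    rw [hparts]
    refine integral_nonpos fun x => ?_
    by_cases hx : x ∈ tsupport ζ
    · refine mul_nonpos_of_nonpos_of_nonneg ?_ (hζ0 x)
      have hball : ball x r ⊆ K := fun y hy =>
        mem_cthickening_of_dist_le y x r _ hx (mem_ball.1 hy).le
      have hmem : ∀ v : EuclideanSpace ℝ (Fin d), ‖v‖ < r → ψ (x + v) = φ (x + v) :=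
        fun v hv => indicator_of_mem (hball (by simpa [mem_ball, dist_eq_norm] using hv)) _
      refine le_trans (le_of_eq ?_) (hdiff x r h (hball.trans hrΩ) (hsb h hh hhs))
      refine Finset.sum_congr rfl fun k _ => ?_
      have hk := hsb h hh hhs k
      rw [hmem _ hk, sub_eq_add_neg x, hmem _ (by rwa [norm_neg]),
        show ψ x = φ x from indicator_of_mem (hsupK hx) _]
    · simp [hζK x hx]
  refine le_of_forall_pos_le_add fun η hη => ?_
  set c : ℝ := η / (d * (∫ x, |ψ x|) + 1) with hcdef
  have hI : 0 ≤ ∫ x, |ψ x| := integral_nonneg fun x => abs_nonneg _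
  have hcpos : 0 < c := by positivity
  choose h₀ hh₀ happ using fun k => abs_secondDifference_sub_le hζ hζc (b k) hcpos
  obtain ⟨h, hh, hhs, hhk⟩ : ∃ h : ℝ, 0 < h ∧ h < s ∧ ∀ k, h < h₀ k := by
    have hev : ∀ᶠ h in nhdsWithin (0 : ℝ) (Ioi 0), 0 < h ∧ h < s ∧ ∀ k, h < h₀ k := by
      filter_upwards [self_mem_nhdsWithin, nhdsWithin_le_nhds (Iio_mem_nhds hs),
        Filter.eventually_all.2 fun k => nhdsWithin_le_nhds (Iio_mem_nhds (hh₀ k))]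
        with h h1 h2 h3 using ⟨h1, h2, h3⟩
    exact hev.exists
  have hqi : Integrable (fun x => ψ x * q x) volume := hi q hqs.continuous
    (HasCompactSupport.intro hζc.isCompact hqK)
  have hTi : Integrable (fun x => ψ x * T h x) volume := by
    have : ∀ x, ψ x * T h x = ∑ k, (ψ x * ζ (x + h • b k) + ψ x * ζ (x + -(h • b k))
        - 2 * (ψ x * ζ (x + 0))) := fun x => by
      rw [hT, Finset.mul_sum]
      exact Finset.sum_congr rfl fun k _ => by rw [← sub_eq_add_neg, add_zero]; ring
    simp only [this]
    exact integrable_finsetSum _ fun k _ =>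
      ((hplus _).add (hplus _)).sub ((hplus 0).const_mul 2)
  have hpt : ∀ x, h ^ 2 * (ψ x * q x) ≤ ψ x * T h x + h ^ 2 * (d * c * |ψ x|) := fun x => by
    have h1 : |T h x - h ^ 2 * q x| ≤ d * (c * h ^ 2) := by
      rw [hT, hq, Finset.mul_sum, ← Finset.sum_sub_distrib]
      refine (Finset.abs_sum_le_sum_abs _ _).trans ?_
      refine (Finset.sum_le_sum fun k _ => happ k h hh (hhk k) x).trans ?_
      simp
    have h2 : |ψ x * (T h x - h ^ 2 * q x)| ≤ |ψ x| * (d * (c * h ^ 2)) := by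
      rw [abs_mul]; gcongr
    nlinarith [(abs_le.1 h2).1]
  have hsum : h ^ 2 * ∫ x, ψ x * q x ≤ h ^ 2 * (d * c * ∫ x, |ψ x|) := by
    have h1 : ∫ x, h ^ 2 * (ψ x * q x) ≤ ∫ x, (ψ x * T h x + h ^ 2 * (d * c * |ψ x|)) :=
      integral_mono (hqi.const_mul _)
        (hTi.add ((hψi.abs.const_mul _).const_mul _)) hpt
    rw [integral_add hTi ((hψi.abs.const_mul _).const_mul _), integral_const_mul,
      integral_const_mul, integral_const_mul] at h1
    linarith [hTnonpos h hh hhs]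
  have h3 : ∫ x, ψ x * q x ≤ d * c * ∫ x, |ψ x| := le_of_mul_le_mul_left hsum (by positivity)
  have h4 : c * (d * (∫ x, |ψ x|) + 1) = η := div_mul_cancel₀ _ (by positivity)
  nlinarith

end ExteriorReifenberg

/-! ### Quadratic barriers and their lower envelope -/

namespace ExteriorReifenberg

open Metric Set MeasureTheory

variable {d : ℕ}

/-- A quadratic polynomial, small at the origin and bounded below by `‖y‖ ^ 2` on the part of the
unit ball where `⟪y, e⟫ < 2 δ`.  In terms of `s = 3 δ - ⟪y, e⟫` it reads `‖y‖ ^ 2 + K s (5 - s)`;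
the term `-K s ^ 2` makes it a supersolution when `K` is large. -/
noncomputable def profile (K δ : ℝ) (e y : EuclideanSpace ℝ (Fin d)) : ℝ :=
  ‖y‖ ^ 2 + K * (3 * δ - inner ℝ y e) * (5 - (3 * δ - inner ℝ y e))

/-- The profile placed at the boundary point `p`, at scale `R` and with weight `w R`. -/
noncomputable def barrier (K δ : ℝ) (w : ℝ → ℝ) (p : EuclideanSpace ℝ (Fin d)) (R : ℝ)
    (e x : EuclideanSpace ℝ (Fin d)) : ℝ :=
  w R * profile K δ e (R⁻¹ • (x - p))

/-- The boundary point `p`, the scale `R ∈ S` and the unit vector `e` are admissible at `x` if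
`x ∈ B(p, R)` and the component of `Ω ∩ B(p, R)` containing `x` lies in the half-space
`⟪y - p, e⟫ < 2 δ R`. -/
structure IsAdmissible (Ω : Set (EuclideanSpace ℝ (Fin d))) (δ : ℝ) (S : Set ℝ)
    (x p : EuclideanSpace ℝ (Fin d)) (R : ℝ) (e : EuclideanSpace ℝ (Fin d)) : Prop where
  mem_frontier : p ∈ frontier Ω
  mem_scales : R ∈ S
  norm_eq : ‖e‖ = 1
  mem_ball : x ∈ ball p R
  inner_lt : ∀ y ∈ connectedComponentIn (Ω ∩ ball p R) x, inner ℝ (y - p) e < 2 * δ * R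

/-- The lower envelope at `x` of all barriers admissible at `x`. -/
noncomputable def barrierInf (Ω : Set (EuclideanSpace ℝ (Fin d))) (K δ : ℝ) (S : Set ℝ)
    (w : ℝ → ℝ) (x : EuclideanSpace ℝ (Fin d)) : ℝ :=
  sInf {t | ∃ p R e, IsAdmissible Ω δ S x p R e ∧ t = barrier K δ w p R e x}

theorem IsAdmissible.of_mem_component {Ω : Set (EuclideanSpace ℝ (Fin d))} {δ : ℝ} {S : Set ℝ}
    {x y p e : EuclideanSpace ℝ (Fin d)} {R : ℝ} (h : IsAdmissible Ω δ S x p R e)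
    (hy : y ∈ connectedComponentIn (Ω ∩ ball p R) x) : IsAdmissible Ω δ S y p R e :=
  ⟨h.mem_frontier, h.mem_scales, h.norm_eq, (connectedComponentIn_subset _ _ hy).2, by
    rw [← connectedComponentIn_eq hy]; exact h.inner_lt⟩

theorem le_profile {K δ : ℝ} (hK : 0 ≤ K) (hδ : 0 ≤ δ) (hδ1 : δ ≤ 1)
    {e y : EuclideanSpace ℝ (Fin d)} (he : ‖e‖ = 1) (hy : ‖y‖ ≤ 1) (hye : inner ℝ y e ≤ 2 * δ) :
    ‖y‖ ^ 2 + K * δ ≤ profile K δ e y := by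
  have h1 : |inner ℝ y e| ≤ 1 := (abs_real_inner_le_norm y e).trans (by rw [he]; linarith)
  have h2 := (abs_le.1 h1).1
  rw [profile]
  have h3 : δ ≤ (3 * δ - inner ℝ y e) * (5 - (3 * δ - inner ℝ y e)) := by nlinarith
  nlinarith [mul_le_mul_of_nonneg_left h3 hK]

theorem profile_le {K δ m : ℝ} (hK : 0 ≤ K) (hδm : δ ≤ m) (hm1 : m ≤ 1)
    {e y : EuclideanSpace ℝ (Fin d)} (he : ‖e‖ = 1) (hy : ‖y‖ ≤ m)
    (hye : inner ℝ y e ≤ 2 * δ) (hδ : 0 ≤ δ) :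
    profile K δ e y ≤ (1 + 20 * K) * m := by
  have h1 : |inner ℝ y e| ≤ m := (abs_real_inner_le_norm y e).trans (by rw [he]; linarith)
  have h2 := (abs_le.1 h1).1
  rw [profile]
  have h3 : (3 * δ - inner ℝ y e) * (5 - (3 * δ - inner ℝ y e)) ≤ 20 * m := by nlinarith
  have h4 : ‖y‖ ^ 2 ≤ m := by nlinarith [norm_nonneg y]
  nlinarith [mul_le_mul_of_nonneg_left h3 hK]

/-- Second differences of the quadratic barrier are exact; their sum along a frame `b` has the
sign of `∑ ‖b k‖ ^ 2 - K ∑ ⟪b k, e⟫ ^ 2`. -/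
theorem sum_secondDifference_barrier_nonpos {K δ : ℝ} {w : ℝ → ℝ} {R : ℝ} (hw : 0 ≤ w R)
    {e : EuclideanSpace ℝ (Fin d)} {b : Fin d → EuclideanSpace ℝ (Fin d)}
    (hb : ∑ k, ‖b k‖ ^ 2 ≤ K * ∑ k, inner ℝ (b k) e ^ 2) (p x : EuclideanSpace ℝ (Fin d)) (h : ℝ) :
    ∑ k, (barrier K δ w p R e (x + h • b k) + barrier K δ w p R e (x - h • b k)
      - 2 * barrier K δ w p R e x) ≤ 0 := by
  have key : ∀ k, barrier K δ w p R e (x + h • b k) + barrier K δ w p R e (x - h • b k)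
      - 2 * barrier K δ w p R e x
      = 2 * w R * (R⁻¹ * h) ^ 2 * (‖b k‖ ^ 2 - K * inner ℝ (b k) e ^ 2) := fun k => by
    have e1 : R⁻¹ • (x + h • b k - p) = R⁻¹ • (x - p) + (R⁻¹ * h) • b k := by
      rw [mul_smul, ← smul_add]; congr 1; abel
    have e2 : R⁻¹ • (x - h • b k - p) = R⁻¹ • (x - p) - (R⁻¹ * h) • b k := by
      rw [mul_smul, ← smul_sub]; congr 1; abel
    have hpar := parallelogram_law_with_norm ℝ (R⁻¹ • (x - p)) ((R⁻¹ * h) • b k)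
    have hn : ‖(R⁻¹ * h) • b k‖ ^ 2 = (R⁻¹ * h) ^ 2 * ‖b k‖ ^ 2 := by
      rw [norm_smul, mul_pow, Real.norm_eq_abs, sq_abs]
    simp only [barrier, profile, e1, e2, inner_add_left, inner_sub_left (𝕜 := ℝ) (R⁻¹ • (x - p)),
      real_inner_smul_left (b k)]
    linear_combination w R * hpar + 2 * w R * hn
  simp only [key]
  rw [← Finset.mul_sum, Finset.sum_sub_distrib, ← Finset.mul_sum]
  exact mul_nonpos_of_nonneg_of_nonpos (by positivity) (by linarith)

theorem continuous_barrier (K δ : ℝ) (w : ℝ → ℝ) (p : EuclideanSpace ℝ (Fin d)) (R : ℝ)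
    (e : EuclideanSpace ℝ (Fin d)) : Continuous (barrier K δ w p R e) := by
  unfold barrier profile
  fun_prop

section Envelope

variable {Ω : Set (EuclideanSpace ℝ (Fin d))} {K δ : ℝ} {S : Set ℝ} {w : ℝ → ℝ}
  {x p e : EuclideanSpace ℝ (Fin d)} {R : ℝ}

theorem IsAdmissible.norm_lt (h : IsAdmissible Ω δ S x p R e) : ‖x - p‖ < R := by
  simpa [dist_eq_norm] using h.mem_ball

theorem IsAdmissible.norm_smul_eq (h : IsAdmissible Ω δ S x p R e) :
    ‖R⁻¹ • (x - p)‖ = ‖x - p‖ / R := by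
  have hR : 0 < R := (norm_nonneg _).trans_lt h.norm_lt
  rw [norm_smul, Real.norm_of_nonneg (by positivity), div_eq_inv_mul]

theorem IsAdmissible.inner_smul_le (h : IsAdmissible Ω δ S x p R e) (hx : x ∈ Ω) :
    inner ℝ (R⁻¹ • (x - p)) e ≤ 2 * δ := by
  have hR : 0 < R := (norm_nonneg _).trans_lt h.norm_lt
  have := h.inner_lt x (mem_connectedComponentIn ⟨hx, h.mem_ball⟩)
  rw [real_inner_smul_left, inv_mul_le_iff₀ hR]
  linarith

theorem IsAdmissible.le_barrier (h : IsAdmissible Ω δ S x p R e) (hx : x ∈ Ω) (hK : 0 ≤ K)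
    (hδ : 0 ≤ δ) (hδ1 : δ ≤ 1) (hw : 0 ≤ w R) :
    w R * ((‖x - p‖ / R) ^ 2 + K * δ) ≤ barrier K δ w p R e x := by
  have hR : 0 < R := (norm_nonneg _).trans_lt h.norm_lt
  rw [barrier, ← h.norm_smul_eq]
  refine mul_le_mul_of_nonneg_left (le_profile hK hδ hδ1 h.norm_eq ?_ (h.inner_smul_le hx)) hw
  rw [h.norm_smul_eq, div_le_one hR]
  exact h.norm_lt.le

theorem IsAdmissible.barrier_le (h : IsAdmissible Ω δ S x p R e) (hx : x ∈ Ω) (hK : 0 ≤ K)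
    (hδ : 0 ≤ δ) (hw : 0 ≤ w R) {m : ℝ} (hδm : δ ≤ m) (hm : m ≤ 1) (hxm : ‖x - p‖ ≤ m * R) :
    barrier K δ w p R e x ≤ w R * ((1 + 20 * K) * m) := by
  have hR : 0 < R := (norm_nonneg _).trans_lt h.norm_lt
  rw [barrier]
  refine mul_le_mul_of_nonneg_left
    (profile_le hK hδm hm h.norm_eq ?_ (h.inner_smul_le hx) hδ) hw
  rw [h.norm_smul_eq, div_le_iff₀ hR]
  exact hxm

/-- Every component is flat at every scale in `S`, so that barriers of every scale in `S` exist. -/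
def IsFlatOn (Ω : Set (EuclideanSpace ℝ (Fin d))) (δ : ℝ) (S : Set ℝ) : Prop :=
  ∀ p ∈ frontier Ω, ∀ R ∈ S, ∀ x ∈ Ω ∩ ball p R, ∃ e, IsAdmissible Ω δ S x p R e

theorem barrierInf_le (hx : x ∈ Ω) (hK : 0 ≤ K) (hδ : 0 ≤ δ) (hδ1 : δ ≤ 1)
    (hw : ∀ R ∈ S, 0 ≤ w R) (h : IsAdmissible Ω δ S x p R e) :
    barrierInf Ω K δ S w x ≤ barrier K δ w p R e x := by
  refine csInf_le ⟨0, ?_⟩ ⟨p, R, e, h, rfl⟩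
  rintro t ⟨p', R', e', h', rfl⟩
  have := hw R' h'.mem_scales
  exact le_trans (by positivity) (h'.le_barrier hx hK hδ hδ1 this)

theorem exists_barrier_lt {t : ℝ} (hne : ∃ p R e, IsAdmissible Ω δ S x p R e)
    (ht : barrierInf Ω K δ S w x < t) :
    ∃ p R e, IsAdmissible Ω δ S x p R e ∧ barrier K δ w p R e x < t := by
  obtain ⟨p, R, e, h⟩ := hne
  have hset : {t | ∃ p R e, IsAdmissible Ω δ S x p R e ∧ t = barrier K δ w p R e x}.Nonempty :=
    ⟨_, p, R, e, h, rfl⟩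
  obtain ⟨_, ⟨p, R, e, h, rfl⟩, hlt⟩ := exists_lt_of_csInf_lt hset ht
  exact ⟨p, R, e, h, hlt⟩

/-- Passing to a larger scale at the same boundary point, a barrier can be replaced by a no larger
one whose ball contains `x` well inside. -/
theorem IsAdmissible.exists_barrier_le (h : IsAdmissible Ω δ S x p R e) (hx : x ∈ Ω)
    (hflat : IsFlatOn Ω δ S) (hK : 0 ≤ K) (hδ : 0 < δ) (hδ2 : δ ≤ 1 / 2)
    (hw : ∀ R ∈ S, 0 ≤ w R)
    (hstep : ∀ R ∈ S, ∃ R' ∈ S, R ≤ δ * R' ∧ w R' * ((1 + 20 * K) * δ) ≤ w R / 4) :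
    ∃ R' e', IsAdmissible Ω δ S x p R' e' ∧ 2 * ‖x - p‖ ≤ R' ∧
      barrier K δ w p R' e' x ≤ barrier K δ w p R e x := by
  have hR : 0 < R := (norm_nonneg _).trans_lt h.norm_lt
  by_cases hclose : 2 * ‖x - p‖ ≤ R
  · exact ⟨R, e, h, hclose, le_rfl⟩
  obtain ⟨R', hR', hRR', hww⟩ := hstep R h.mem_scales
  have hxR' : ‖x - p‖ ≤ δ * R' := h.norm_lt.le.trans hRR'
  have hR'0 : 0 < R' := pos_of_mul_pos_right (hR.trans_le hRR') hδ.le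
  have hlt : ‖x - p‖ < R' := by nlinarith
  obtain ⟨e', h'⟩ := hflat p h.mem_frontier R' hR' x
    ⟨hx, by simpa [Metric.mem_ball, dist_eq_norm] using hlt⟩
  refine ⟨R', e', h', by nlinarith, ?_⟩
  have h1 := h'.barrier_le hx hK hδ.le (hw R' hR') le_rfl (by linarith) hxR'
  have h2 := h.le_barrier hx hK hδ.le (by linarith) (hw R h.mem_scales)
  have h3 : 1 / 2 ≤ ‖x - p‖ / R := by rw [le_div_iff₀ hR]; linarith [not_le.1 hclose]
  have h4 : 1 / 4 ≤ (‖x - p‖ / R) ^ 2 + K * δ := by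
    have := mul_nonneg hK hδ.le
    nlinarith
  have h5 := mul_le_mul_of_nonneg_left h4 (hw R h.mem_scales)
  linarith

/-- Near-minimal barriers at `x` dominate the envelope on every ball about `x` inside `Ω`, so the
envelope inherits the sign of their second differences. -/
theorem sum_secondDifference_barrierInf_nonpos
    (hne : ∀ x ∈ Ω, ∃ p R e, IsAdmissible Ω δ S x p R e)
    (hflat : IsFlatOn Ω δ S) (hK : 0 ≤ K) (hδ : 0 < δ) (hδ2 : δ ≤ 1 / 2)
    (hw : ∀ R ∈ S, 0 ≤ w R)
    (hstep : ∀ R ∈ S, ∃ R' ∈ S, R ≤ δ * R' ∧ w R' * ((1 + 20 * K) * δ) ≤ w R / 4)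
    (hΩ : IsOpen Ω) {b : Fin d → EuclideanSpace ℝ (Fin d)}
    (hb : ∀ e : EuclideanSpace ℝ (Fin d), ‖e‖ = 1 →
      ∑ k, ‖b k‖ ^ 2 ≤ K * ∑ k, inner ℝ (b k) e ^ 2)
    {r h : ℝ} (hr : 0 < r) (hball : ball x r ⊆ Ω) (hh : ∀ k, ‖h • b k‖ < r) :
    ∑ k, (barrierInf Ω K δ S w (x + h • b k) + barrierInf Ω K δ S w (x - h • b k)
      - 2 * barrierInf Ω K δ S w x) ≤ 0 := by
  have hx : x ∈ Ω := hball (mem_ball_self hr)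
  refine le_of_forall_pos_le_add fun η hη => ?_
  obtain ⟨p, R₁, e₁, hadm₁, hlt₁⟩ := exists_barrier_lt (K := K) (w := w) (hne x hx)
    (lt_add_of_pos_right _ (show 0 < η / (2 * d + 1) by positivity))
  obtain ⟨R, e, hadm, hclose, hle⟩ :=
    hadm₁.exists_barrier_le hx hflat hK hδ hδ2 hw hstep
  have hnear := hle.trans_lt hlt₁
  have hpr : r ≤ ‖x - p‖ := by
    by_contra! hlt
    have hp : p ∈ Ω := hball (by rw [Metric.mem_ball, dist_comm, dist_eq_norm]; exact hlt)
    have := hadm.mem_frontier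
    rw [hΩ.frontier_eq] at this
    exact this.2 hp
  have hballR : ball x r ⊆ ball p R := ball_subset_ball' (by rw [dist_eq_norm]; linarith)
  have hcomp : ball x r ⊆ connectedComponentIn (Ω ∩ ball p R) x :=
    (convex_ball x r).isPreconnected.subset_connectedComponentIn (mem_ball_self hr)
      (subset_inter hball hballR)
  have hdom : ∀ v : EuclideanSpace ℝ (Fin d), ‖v‖ < r →
      barrierInf Ω K δ S w (x + v) ≤ barrier K δ w p R e (x + v) := fun v hv => by
    have hm : x + v ∈ ball x r := by simpa [Metric.mem_ball, dist_eq_norm] using hv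
    exact barrierInf_le (hball hm) hK hδ.le (by linarith) hw
      (hadm.of_mem_component (hcomp hm))
  have hb' := sum_secondDifference_barrier_nonpos (δ := δ) (hw R hadm.mem_scales)
    (hb e hadm.norm_eq) p x h
  calc _ ≤ ∑ k, (barrier K δ w p R e (x + h • b k) + barrier K δ w p R e (x - h • b k)
      - 2 * barrier K δ w p R e x + 2 * (η / (2 * d + 1))) := by
        refine Finset.sum_le_sum fun k _ => ?_
        have h1 := hdom _ (hh k)
        have h2 := hdom (-(h • b k)) (by rw [norm_neg]; exact hh k)
        rw [← sub_eq_add_neg] at h2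
        linarith
    _ ≤ 0 + η := by
        rw [Finset.sum_add_distrib]
        refine add_le_add hb' ?_
        simp only [Finset.sum_const, Finset.card_univ, Fintype.card_fin, nsmul_eq_mul]
        have : η / (2 * d + 1) * (2 * d + 1) = η := div_mul_cancel₀ _ (by positivity)
        nlinarith [show 0 < η / (2 * d + 1) by positivity]

/-- The envelope is upper semicontinuous on `Ω`, because admissibility is an open condition. -/
theorem measurable_barrierInf (hne : ∀ x ∈ Ω, ∃ p R e, IsAdmissible Ω δ S x p R e)
    (hK : 0 ≤ K) (hδ : 0 ≤ δ) (hδ1 : δ ≤ 1) (hw : ∀ R ∈ S, 0 ≤ w R) (hΩ : IsOpen Ω) :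
    Measurable fun x : Ω => barrierInf Ω K δ S w x := by
  refine measurable_of_Iio fun t => IsOpen.measurableSet ?_
  rw [isOpen_iff_mem_nhds]
  rintro ⟨x, hx⟩ hxt
  obtain ⟨p, R, e, hadm, hlt⟩ := exists_barrier_lt (hne x hx) hxt
  have h1 : connectedComponentIn (Ω ∩ ball p R) x ∈ nhds x :=
    (hΩ.inter isOpen_ball).connectedComponentIn.mem_nhds
      (mem_connectedComponentIn ⟨hx, hadm.mem_ball⟩)
  have h2 := (continuous_barrier K δ w p R e).continuousAt.eventually_lt_const hlt
  filter_upwards [continuous_subtype_val.continuousAt.eventually (Filter.eventually_mem_set.2 h1),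
    continuous_subtype_val.continuousAt.eventually h2] with y hy1 hy2
  exact (barrierInf_le y.2 hK hδ hδ1 hw (hadm.of_mem_component hy1)).trans_lt hy2

end Envelope

end ExteriorReifenberg

/-! ### Scales, weights and the frame of a matrix -/

namespace ExteriorReifenberg

open Metric Set MeasureTheory

variable {d : ℕ}

theorem sum_norm_sq_frame_le {ν₁ : ℝ} {α : Matrix (Fin d) (Fin d) ℝ}
    (hα : α ∈ ellipticMatrices d ν₁ 1) {b : Fin d → EuclideanSpace ℝ (Fin d)}
    (hb : ∀ i j, α i j = ∑ k, b k i * b k j) : ∑ k, ‖b k‖ ^ 2 ≤ d := by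
  have hdiag : ∀ i, α i i ≤ 1 := fun i => by
    have := (hα.2 (EuclideanSpace.single i 1)).2
    simpa [Pi.single_apply] using this
  calc ∑ k, ‖b k‖ ^ 2 = ∑ i, α i i := by
        simp only [EuclideanSpace.norm_sq_eq, hb, Real.norm_eq_abs, sq_abs, ← sq]
        exact Finset.sum_comm
    _ ≤ ∑ _i : Fin d, (1 : ℝ) := Finset.sum_le_sum fun i _ => hdiag i
    _ = d := by simp

theorem le_sum_inner_sq_frame {ν₁ ν₂ : ℝ} {α : Matrix (Fin d) (Fin d) ℝ}
    (hα : α ∈ ellipticMatrices d ν₁ ν₂) {b : Fin d → EuclideanSpace ℝ (Fin d)}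
    (hb : ∀ i j, α i j = ∑ k, b k i * b k j) {e : EuclideanSpace ℝ (Fin d)} (he : ‖e‖ = 1) :
    ν₁ ≤ ∑ k, inner ℝ (b k) e ^ 2 := by
  have h := (hα.2 e).1
  rw [he, one_pow, mul_one] at h
  refine h.trans_eq ?_
  simp only [hb, PiLp.inner_apply, sq, Finset.sum_mul, Finset.mul_sum, RCLike.inner_apply,
    conj_trivial]
  rw [(Finset.sum_congr rfl fun i _ => Finset.sum_comm).trans Finset.sum_comm]
  refine Finset.sum_congr rfl fun k _ => ?_
  exact Finset.sum_congr rfl fun i _ => Finset.sum_congr rfl fun j _ => by ring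

theorem IsTotallyExterior.isFlatOn (hd : 2 ≤ d) {Ω : Set (EuclideanSpace ℝ (Fin d))}
    {δ δ₁ R₀ Rinf : ℝ} (h : IsTotallyExterior Ω δ R₀ Rinf) (hδ : δ ≤ δ₁) (hδ₁ : 0 < δ₁) :
    IsFlatOn Ω δ₁ {R | 0 < R ∧ (R ≤ R₀ ∨ Rinf ≤ R)} := by
  rintro p hp R ⟨hR, hRS⟩ x hx
  -- `δ = 1` always belongs to the set defining the infimum, so the infimum is approximated.
  have hne : {δ : ℝ | (δ, R) ∈ exteriorPairs Ω}.Nonempty := by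
    refine ⟨1, ⟨zero_le_one, le_rfl⟩, hR, fun p _ z _ => ?_⟩
    have he : ‖(EuclideanSpace.single ⟨0, by omega⟩ (1 : ℝ) : EuclideanSpace ℝ (Fin d))‖ = 1 := by
      simp
    refine ⟨_, he, fun y hy => ?_⟩
    have hyb : y ∈ ball p R := (connectedComponentIn_subset _ _ hy).2
    refine ⟨hyb, ?_⟩
    have h1 := real_inner_le_norm (y - p) (EuclideanSpace.single ⟨0, by omega⟩ (1 : ℝ))
    rw [he, mul_one, ← dist_eq_norm] at h1
    rw [one_mul]
    exact h1.trans_lt hyb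
  obtain ⟨δ', hδ', hlt⟩ := exists_lt_of_csInf_lt hne
    (show exteriorFlatness Ω R < 2 * δ₁ by linarith [h.flat R hR hRS])
  obtain ⟨e, he, hsub⟩ := hδ'.2.2 p hp x hx
  refine ⟨e, hp, ⟨hR, hRS⟩, he, hx.2, fun y hy => (hsub hy).2.trans ?_⟩
  exact mul_lt_mul_of_pos_right hlt hR

/-- Since `M ^ ε = 4 B`, enlarging a scale by the factor `M` multiplies its weight by `M ^ (1 - ε)`,
which the smallness `B / M` of the barrier outweighs. -/
theorem rpow_step {ε M B t u : ℝ} (hε : ε ∈ Ioo (0 : ℝ) 1) (hM : 0 < M) (hMB : M ^ ε = 4 * B)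
    (ht : 0 ≤ t) (htu : t ≤ u) : (M * t) ^ (1 - ε) * (B * M⁻¹) ≤ u ^ (1 - ε) / 4 := by
  have h1 : M ^ (1 - ε) * (B * M⁻¹) = 1 / 4 := by
    rw [Real.rpow_sub hM, Real.rpow_one, hMB]
    have : B ≠ 0 := by
      rintro rfl
      have := Real.rpow_pos_of_pos hM ε
      linarith
    field_simp
  rw [Real.mul_rpow hM.le ht]
  have h2 := Real.rpow_le_rpow ht htu (by linarith [hε.2] : 0 ≤ 1 - ε)
  calc _ = t ^ (1 - ε) * (M ^ (1 - ε) * (B * M⁻¹)) := by ring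
    _ = t ^ (1 - ε) / 4 := by rw [h1]; ring
    _ ≤ _ := by linarith

theorem infDist_frontier_pos {Ω : Set (EuclideanSpace ℝ (Fin d))} (hΩ : IsOpen Ω)
    (hfr : (frontier Ω).Nonempty) {x : EuclideanSpace ℝ (Fin d)} (hx : x ∈ Ω) :
    0 < infDist x (frontier Ω) := by
  refine (isClosed_frontier.notMem_iff_infDist_pos hfr).1 fun h => ?_
  rw [hΩ.frontier_eq] at h
  exact h.2 hx

theorem locallyIntegrableOn_of_measurable_of_bound {Ω : Set (EuclideanSpace ℝ (Fin d))}
    (hΩ : IsOpen Ω) {φ g : EuclideanSpace ℝ (Fin d) → ℝ} (hφ : Measurable fun x : Ω => φ x)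
    (hg : Continuous g) (hb : ∀ x ∈ Ω, |φ x| ≤ g x) : LocallyIntegrableOn φ Ω volume := by
  rw [locallyIntegrableOn_iff hΩ.isLocallyClosed]
  intro k hkΩ hk
  have hφΩ : AEStronglyMeasurable φ (volume.restrict Ω) :=
    (aemeasurable_restrict_of_measurable_subtype hΩ.measurableSet hφ).aestronglyMeasurable
  refine (hg.continuousOn.integrableOn_compact hk).mono' (hφΩ.mono_set hkΩ) ?_
  exact (ae_restrict_iff' hk.isClosed.measurableSet).2
    (Filter.Eventually.of_forall fun x hx => hb x (hkΩ hx))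

/-- The weight `(c R) ^ (1 - ε)` of the scale `R`, where `c = A` at the small scales `R ≤ R₀` and
`c = 1` at the others.  The factor `A` makes the weights of the small scales next to `R₀` at least
as large as the weight of the first large scale, across the gap where no flatness is known. -/
noncomputable def scaleWeight (ε A R₀ R : ℝ) : ℝ :=
  ((if R ≤ R₀ then A else 1) * R) ^ (1 - ε)

/-- Every scale `R` has a scale at least `M` times larger at which a barrier is, within
`B(p, R)`, at most a quarter of the weight of `R`.  For `R ≤ R₀ < M R` it is `M * Rinf`. -/
theorem exists_larger_scale {ε M B κ R₀ Rinf R : ℝ} (hε : ε ∈ Ioo (0 : ℝ) 1) (hM : 1 < M)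
    (hMB : M ^ ε = 4 * B) (hκ : 0 < κ) (hR₀ : 0 < R₀) (hle : R₀ ≤ Rinf) (hκeq : R₀ / Rinf = κ)
    (hR : R ∈ {R | 0 < R ∧ (R ≤ R₀ ∨ Rinf ≤ R)}) :
    ∃ R' ∈ {R | 0 < R ∧ (R ≤ R₀ ∨ Rinf ≤ R)}, R ≤ M⁻¹ * R' ∧
      scaleWeight ε (M / κ) R₀ R' * (B * M⁻¹) ≤ scaleWeight ε (M / κ) R₀ R / 4 := by
  obtain ⟨hR0, hRS⟩ := hR
  have hM0 : 0 < M := by linarith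
  have hinf : 0 < Rinf := hR₀.trans_le hle
  have hcancel : ∀ t : ℝ, M⁻¹ * (M * t) = t := fun t => inv_mul_cancel_left₀ hM0.ne' t
  have hκR : Rinf * κ = R₀ := by rw [← hκeq]; field_simp
  have hgrow : R < M * R := lt_mul_of_one_lt_left hR0 hM
  by_cases hs : R ≤ R₀
  · by_cases hsM : M * R ≤ R₀
    · refine ⟨M * R, ⟨by positivity, Or.inl hsM⟩, (hcancel R).ge, ?_⟩
      rw [scaleWeight, scaleWeight, if_pos hsM, if_pos hs, mul_left_comm (M / κ)]
      exact rpow_step hε hM0 hMB (by positivity) le_rfl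
    · have hbig : Rinf < M * Rinf := lt_mul_of_one_lt_left hinf hM
      refine ⟨M * Rinf, ⟨by positivity, Or.inr hbig.le⟩, by rw [hcancel]; linarith, ?_⟩
      rw [scaleWeight, scaleWeight, if_neg (by linarith), if_pos hs, one_mul]
      refine rpow_step hε hM0 hMB hinf.le ?_
      rw [div_mul_eq_mul_div, le_div_iff₀ hκ, hκR]
      exact (not_le.1 hsM).le
  · have hRinf : Rinf ≤ R := hRS.resolve_left hs
    refine ⟨M * R, ⟨by positivity, Or.inr (by linarith)⟩, (hcancel R).ge, ?_⟩
    rw [scaleWeight, scaleWeight, if_neg (by linarith), if_neg hs, one_mul, one_mul]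
    exact rpow_step hε hM0 hMB hR0.le le_rfl

theorem exists_comparable_scale {κ R₀ Rinf ρ : ℝ} (hκ : 0 < κ) (hκ1 : κ ≤ 1) (hR₀ : 0 < R₀)
    (hle : R₀ ≤ Rinf) (hκeq : R₀ / Rinf = κ) (hρ : 0 < ρ) :
    ∃ R ∈ {R | 0 < R ∧ (R ≤ R₀ ∨ Rinf ≤ R)}, ρ < R ∧ R ≤ 2 * ρ / κ := by
  by_cases h : 2 * ρ ≤ R₀ ∨ Rinf ≤ 2 * ρ
  · refine ⟨2 * ρ, ⟨by positivity, h⟩, by linarith, ?_⟩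
    rw [le_div_iff₀ hκ]
    nlinarith
  · push Not at h
    have hinf : 0 < Rinf := hR₀.trans_le hle
    refine ⟨Rinf, ⟨hinf, Or.inr le_rfl⟩, by linarith, ?_⟩
    have hκR : Rinf * κ = R₀ := by rw [← hκeq]; field_simp
    rw [le_div_iff₀ hκ, hκR]
    exact h.1.le

end ExteriorReifenberg

open ExteriorReifenberg in
theorem theorem22p02p19p6 (d : ℕ) (hd : 2 ≤ d) (ν : ℝ) (hν : ν ∈ Set.Ioc (0 : ℝ) 1)
    (ε : ℝ) (hε : ε ∈ Set.Ioo (0 : ℝ) 1) :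
    ∃ δ₁ : ℝ, 0 < δ₁ ∧
      ∀ κ : ℝ, 0 < κ → κ ≤ 1 → ∃ N : ℝ, 0 < N ∧
        ∀ (Ω : Set (EuclideanSpace ℝ (Fin d))) (δ R₀ Rinf : ℝ),
          IsOpen Ω → IsConnected Ω → Ω ≠ Set.univ →
          δ ≤ δ₁ → ExteriorReifenberg.IsTotallyExterior Ω δ R₀ Rinf → R₀ / Rinf = κ →
          ∃ φ : EuclideanSpace ℝ (Fin d) → ℝ,
            Measurable (fun x : Ω => φ x) ∧
            (∀ α ∈ ExteriorReifenberg.ellipticMatrices d (ν ^ 2) 1,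
              ExteriorReifenberg.DistribSuper Ω α φ) ∧
            ∀ x ∈ Ω,
              N⁻¹ * Metric.infDist x (frontier Ω) ^ (1 - ε) ≤ φ x ∧
                φ x ≤ N * Metric.infDist x (frontier Ω) ^ (1 - ε) := by
  have hν0 : 0 < ν := hν.1
  have hd0 : (0 : ℝ) < d := by exact_mod_cast (by omega : 0 < d)
  set K : ℝ := d / ν ^ 2 with hKdef
  have hK : 0 < K := by positivity
  set B : ℝ := 1 + 20 * K with hB
  have hB1 : 1 ≤ B := by linarith
  -- `M` is chosen so that the barriers of scale `M R` beat those of scale `R` away from the center.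
  set M : ℝ := (4 * B) ^ (1 / ε) with hM
  have hMB : M ^ ε = 4 * B := by
    rw [hM, ← Real.rpow_mul (by linarith), one_div_mul_cancel hε.1.ne', Real.rpow_one]
  have hM2 : 2 ≤ M := by
    have h1 : (4 * B) ^ (1 : ℝ) ≤ M :=
      Real.rpow_le_rpow_of_exponent_le (by linarith) ((one_le_div hε.1).2 hε.2.le)
    rw [Real.rpow_one] at h1
    linarith
  have hM0 : 0 < M := by linarith
  have ha : 0 ≤ 1 - ε := by linarith [hε.2]
  have hδ2 : M⁻¹ ≤ 1 / 2 := by rw [one_div]; exact inv_anti₀ two_pos hM2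
  have hδ0 : 0 < M⁻¹ := by positivity
  refine ⟨M⁻¹, hδ0, fun κ hκ hκ1 => ?_⟩
  have hc : 1 ≤ M / κ := by rw [le_div_iff₀ hκ]; linarith
  set N₁ : ℝ := (M / κ * (2 / κ)) ^ (1 - ε) * B with hN₁
  have hN₁0 : 0 ≤ N₁ := by positivity
  refine ⟨N₁ + (K * M⁻¹)⁻¹, by positivity, ?_⟩
  intro Ω δ R₀ Rinf hΩ hconn hne hδ hext hκeq
  have hfr : (frontier Ω).Nonempty := nonempty_frontier_iff.2 ⟨hconn.nonempty, hne⟩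
  have hflat := hext.isFlatOn hd hδ hδ0
  have hR₀ := hext.pos
  have hle := hext.le
  set S : Set ℝ := {R | 0 < R ∧ (R ≤ R₀ ∨ Rinf ≤ R)} with hS
  set w : ℝ → ℝ := scaleWeight ε (M / κ) R₀ with hw
  have hw_le : ∀ R ∈ S, w R ≤ (M / κ * R) ^ (1 - ε) := fun R hR => by
    have h0 : 0 < R := hR.1
    rw [hw, scaleWeight]
    split_ifs
    · exact le_rfl
    · exact Real.rpow_le_rpow (by positivity) (mul_le_mul_of_nonneg_right hc h0.le) ha
  have le_hw : ∀ R ∈ S, R ^ (1 - ε) ≤ w R := fun R hR => by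
    have h0 : 0 < R := hR.1
    rw [hw, scaleWeight]
    split_ifs
    · exact Real.rpow_le_rpow h0.le (le_mul_of_one_le_left h0.le hc) ha
    · rw [one_mul]
  have hw0 : ∀ R ∈ S, 0 ≤ w R := fun R hR => (Real.rpow_nonneg hR.1.le _).trans (le_hw R hR)
  have hstep : ∀ R ∈ S, ∃ R' ∈ S, R ≤ M⁻¹ * R' ∧ w R' * (B * M⁻¹) ≤ w R / 4 := fun R hR =>
    exists_larger_scale hε (by linarith) hMB hκ hR₀ hle hκeq hR
  have hscale : ∀ x ∈ Ω, ∃ p R e, IsAdmissible Ω M⁻¹ S x p R e ∧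
      R ≤ 2 * Metric.infDist x (frontier Ω) / κ := fun x hx => by
    obtain ⟨p, hp, hxp⟩ := isClosed_frontier.exists_infDist_eq_dist hfr x
    obtain ⟨R, hR, hρR, hRρ⟩ := exists_comparable_scale hκ hκ1 hR₀ hle hκeq
      (infDist_frontier_pos hΩ hfr hx)
    obtain ⟨e, he⟩ := hflat p hp R hR x ⟨hx, by rwa [Metric.mem_ball, ← hxp]⟩
    exact ⟨p, R, e, he, hRρ⟩
  have hadm : ∀ x ∈ Ω, ∃ p R e, IsAdmissible Ω M⁻¹ S x p R e := fun x hx => by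
    obtain ⟨p, R, e, h, -⟩ := hscale x hx
    exact ⟨p, R, e, h⟩
  set φ := barrierInf Ω K M⁻¹ S w with hφ
  have hlower : ∀ x ∈ Ω, K * M⁻¹ * Metric.infDist x (frontier Ω) ^ (1 - ε) ≤ φ x := by
    intro x hx
    obtain ⟨p₀, R₁, e₀, h₀⟩ := hadm x hx
    refine le_csInf ⟨_, p₀, R₁, e₀, h₀, rfl⟩ ?_
    rintro t ⟨p, R, e, h, rfl⟩
    have hρR : Metric.infDist x (frontier Ω) ≤ R := by
      refine (Metric.infDist_le_dist_of_mem h.mem_frontier).trans ?_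
      rw [dist_eq_norm]
      exact h.norm_lt.le
    have h1 := Real.rpow_le_rpow Metric.infDist_nonneg hρR ha
    have h2 := le_hw R h.mem_scales
    refine le_trans ?_ (h.le_barrier hx hK.le hδ0.le (by linarith) (hw0 R h.mem_scales))
    rw [mul_comm]
    refine mul_le_mul (h1.trans h2) ?_ (by positivity) (hw0 R h.mem_scales)
    exact le_add_of_nonneg_left (sq_nonneg _)
  have hupper : ∀ x ∈ Ω, φ x ≤ N₁ * Metric.infDist x (frontier Ω) ^ (1 - ε) := by
    intro x hx
    obtain ⟨p, R, e, h, hRρ⟩ := hscale x hx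
    have hR0 : 0 < R := h.mem_scales.1
    have hρ : 0 ≤ Metric.infDist x (frontier Ω) := Metric.infDist_nonneg
    refine (barrierInf_le hx hK.le hδ0.le (by linarith) hw0 h).trans ?_
    refine (h.barrier_le hx hK.le hδ0.le (hw0 R h.mem_scales) (by linarith) le_rfl
      (by rw [one_mul]; exact h.norm_lt.le)).trans ?_
    have h1 : w R ≤ (M / κ * (2 / κ) * Metric.infDist x (frontier Ω)) ^ (1 - ε) := by
      refine (hw_le R h.mem_scales).trans (Real.rpow_le_rpow (by positivity) ?_ ha)
      rw [mul_assoc (M / κ)]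
      refine mul_le_mul_of_nonneg_left (hRρ.trans_eq (by ring)) (by positivity)
    rw [Real.mul_rpow (by positivity) hρ] at h1
    rw [mul_one, hN₁, mul_right_comm]
    exact mul_le_mul_of_nonneg_right h1 (by linarith)
  have hmeas : Measurable fun x : Ω => φ x :=
    measurable_barrierInf hadm hK.le hδ0.le (by linarith) hw0 hΩ
  have hφ0 : ∀ x ∈ Ω, 0 ≤ φ x := fun x hx =>
    le_trans (mul_nonneg (by positivity) (Real.rpow_nonneg Metric.infDist_nonneg _)) (hlower x hx)
  have hloc : MeasureTheory.LocallyIntegrableOn φ Ω MeasureTheory.volume := by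
    refine locallyIntegrableOn_of_measurable_of_bound hΩ hmeas
      (g := fun x => N₁ * Metric.infDist x (frontier Ω) ^ (1 - ε)) ?_ fun x hx => ?_
    · exact continuous_const.mul
        ((Metric.continuous_infDist_pt _).rpow_const fun _ => Or.inr ha)
    · rw [abs_of_nonneg (hφ0 x hx)]
      exact hupper x hx
  refine ⟨φ, hmeas, fun α hα => ?_, fun x hx => ⟨?_, ?_⟩⟩
  · obtain ⟨b, hb⟩ := exists_frame_of_mem_ellipticMatrices (by positivity) hα
    have hbK : ∀ e : EuclideanSpace ℝ (Fin d), ‖e‖ = 1 →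
        ∑ k, ‖b k‖ ^ 2 ≤ K * ∑ k, inner ℝ (b k) e ^ 2 := fun e he => by
      refine (sum_norm_sq_frame_le hα hb).trans ?_
      have h1 := mul_le_mul_of_nonneg_left (le_sum_inner_sq_frame hα hb he) hK.le
      rwa [hKdef, div_mul_cancel₀ _ (by positivity), ← hKdef] at h1
    refine distribSuper_of_secondDifference_nonpos hΩ hb hloc fun x r h hball hh => ?_
    have hr : 0 < r := (norm_nonneg _).trans_lt (hh ⟨0, by omega⟩)
    exact sum_secondDifference_barrierInf_nonpos hadm hflat hK.le hδ0 hδ2 hw0 hstep hΩ hbK hr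
      hball hh
  · refine le_trans (mul_le_mul_of_nonneg_right ?_
      (Real.rpow_nonneg Metric.infDist_nonneg _)) (hlower x hx)
    rw [← inv_inv (K * M⁻¹)]
    exact inv_anti₀ (by positivity) (by rw [inv_inv]; linarith)
  · refine (hupper x hx).trans (mul_le_mul_of_nonneg_right ?_
      (Real.rpow_nonneg Metric.infDist_nonneg _))
    exact le_add_of_nonneg_right (by positivity)
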